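/- Let $A$ and $B$ be (complex, not necessarily unital) C$^*$-algebras, each equipped with the ternary product $[a,b,c]:=ab^*c$ and the Jordan triple product $\{a,b,c\}:=\frac12(ab^*c+cb^*a)$. Let $S:A\to B$ be a triple homomorphism, that is, a complex-linear map with $S(\{a,b,c\})=\{S(a),S(b),S(c)\}$ for all $a,b,c\in A$. Then the following statements are equivalent: 1) $S$ is a TRO homomorphism, that is, $S([a,b,c])=[S(a),S(b),S(c)]$ for all $a,b,c\in A$; 2) $S$ preserves zero-TRO products, that is, for all $a,b,c\in A$, $[a,b,c]=0$ implies $[S(a),S(b),S(c)]=0$; 3) for all $a,b\in A$, $ab^*=0$ implies $S(a)S(b)^*=0$. -/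

import Mathlib

/-- The ternary product `[a, b, c] = a b* c` of a C*-algebra. -/
def troProduct {A : Type*} [NonUnitalCStarAlgebra A] (a b c : A) : A :=
  a * star b * c

/-- The Jordan triple product `{a, b, c} = (a b* c + c b* a) / 2` of a C*-algebra. -/
noncomputable def tripleProduct {A : Type*} [NonUnitalCStarAlgebra A] (a b c : A) : A :=
  (1 / 2 : ℂ) • (troProduct a b c + troProduct c b a)

/-- A linear map between C*-algebras is a triple homomorphism if it preserves the Jordan
triple product. -/
def IsTripleHom {A B : Type*} [NonUnitalCStarAlgebra A] [NonUnitalCStarAlgebra B]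
    (T : A →ₗ[ℂ] B) : Prop :=
  ∀ a b c : A, T (tripleProduct a b c) = tripleProduct (T a) (T b) (T c)

/-- A linear map between C*-algebras is a TRO homomorphism if it preserves the ternary
product. -/
def IsTROHom {A B : Type*} [NonUnitalCStarAlgebra A] [NonUnitalCStarAlgebra B]
    (T : A →ₗ[ℂ] B) : Prop :=
  ∀ a b c : A, T (troProduct a b c) = troProduct (T a) (T b) (T c)

/-- A linear map between C*-algebras preserves zero-TRO products if
`[T a, T b, T c] = 0` whenever `[a, b, c] = 0`. -/
def PreservesZeroTROProducts {A B : Type*} [NonUnitalCStarAlgebra A]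
    [NonUnitalCStarAlgebra B] (T : A →ₗ[ℂ] B) : Prop :=
  ∀ a b c : A, troProduct a b c = 0 → troProduct (T a) (T b) (T c) = 0

/-!
The implication from ternary homomorphisms to zero-product preservation is immediate, and
`[S a, S b, S b] = 0` forces `S a (S b)* = 0` by the C*-identity. The substance is that a triple
homomorphism `S` which preserves the relation `a b* = 0` preserves `a b* c`.

A triple homomorphism is contractive (`IsTripleHom.norm_map_le`), by comparing the resolvents of
`a* a` and `(S a)* S a`. For a bounded linear map preserving `a b* = 0`, the form `S a (S b)*` is
balanced: `S (a x) (S b)* = S a (S (b x*))*` (`map_mul_mul_star`). It suffices to treat a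
self-adjoint `x = h`. There a partition of unity by tent functions of `h` is inserted on both sides:
the pairs with disjoint supports contribute nothing, and the remaining ones are bounded
independently of the fineness of the partition.

Put `E a b c = S a (S b)* S c - S (a b* c)`. The Jordan identity says that `E` is antisymmetric in
`a` and `c`, and balancedness of the form gives `E (a x) b c = E a (b x*) c`. These two properties
force `E (x v) b (x w) = 0` (`eq_zero_of_antisymm_of_balanced`). Letting `x` run through an
approximate unit and using continuity yields `E = 0`.
-/

/-! ### Contractivity of triple homomorphisms -/

lemma IsTripleHom.map_mul_star_mul_add {A B : Type*} [NonUnitalCStarAlgebra A]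
    [NonUnitalCStarAlgebra B] {S : A →ₗ[ℂ] B} (hS : IsTripleHom S) (a b c : A) :
    S (a * star b * c) + S (c * star b * a) =
      S a * star (S b) * S c + S c * star (S b) * S a := by
  have h := hS a b c
  rw [tripleProduct, tripleProduct, map_smul, map_add] at h
  exact smul_right_injective B (by norm_num : (1 / 2 : ℂ) ≠ 0) h

lemma IsTripleHom.map_mul_star_mul_self {A B : Type*} [NonUnitalCStarAlgebra A]
    [NonUnitalCStarAlgebra B] {S : A →ₗ[ℂ] B} (hS : IsTripleHom S) (a b : A) :
    S (a * star b * a) = S a * star (S b) * S a := by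
  have h := hS.map_mul_star_mul_add a b a
  rw [← two_smul ℂ, ← two_smul ℂ] at h
  exact smul_right_injective B (two_ne_zero : (2 : ℂ) ≠ 0) h

/-- The norm of `k = y* y` is a spectral value of `k`, so `‖k‖ - k` has no resolvent; the equation
for `w` says that `‖k‖ + k + w` would be one up to a scalar. -/
lemma eq_zero_of_norm_smul_sub_mul_eq {B : Type*} [NonUnitalCStarAlgebra B] {y w : B}
    (hw : star w = w)
    (h : ‖star y * y‖ • w - star y * y * w = star y * y * (star y * y)) : y = 0 := by
  by_contra hy
  set k := star y * y with hk
  have hks : star k = k := by simp [hk]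
  have hμ : ‖k‖ ≠ 0 := by simpa [hk, CStarRing.norm_star_mul_self] using hy
  have h' : ‖k‖ • w - w * k = k * k := by
    have := congrArg star h
    simpa [hks, hw] using this
  let := CStarAlgebra.spectralOrder (Unitization ℂ B)
  let := CStarAlgebra.spectralOrderedRing (Unitization ℂ B)
  have hmem : ‖k‖ ∈ spectrum ℝ (k : Unitization ℂ B) := by
    rw [← Unitization.norm_inr (𝕜 := ℂ) (A := B) k]
    refine CStarAlgebra.norm_mem_spectrum_of_nonneg ?_
    rw [hk, Unitization.inr_mul, Unitization.inr_star]
    exact star_mul_self_nonneg _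
  have e : (↑(‖k‖ • w) : Unitization ℂ B) = algebraMap ℝ (Unitization ℂ B) ‖k‖ * (w : _) := by
    rw [Unitization.inr_smul, Algebra.smul_def]
  have hc := Algebra.commutes ‖k‖ (k : Unitization ℂ B)
  have hcw := Algebra.commutes ‖k‖ (w : Unitization ℂ B)
  have h1 := congrArg (Unitization.inr (R := ℂ)) h
  have h2 := congrArg (Unitization.inr (R := ℂ)) h'
  simp only [Unitization.inr_sub, Unitization.inr_mul, e] at h1 h2
  have hu : IsUnit (algebraMap ℝ (Unitization ℂ B) ‖k‖ *
      algebraMap ℝ (Unitization ℂ B) ‖k‖) := by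
    rw [← map_mul]
    exact (IsUnit.mk0 _ (mul_ne_zero hμ hμ)).map _
  refine hmem (show IsUnit (algebraMap ℝ (Unitization ℂ B) ‖k‖ - (k : Unitization ℂ B)) from ?_)
  generalize algebraMap ℝ (Unitization ℂ B) ‖k‖ = m at *
  generalize (k : Unitization ℂ B) = K at *
  generalize (w : Unitization ℂ B) = W at *
  have r : (m - K) * (m + K + W) = m * m := by
    have : (m - K) * (m + K + W) = m * m + (m * K - K * m) + (m * W - K * W) - K * K := by
      noncomm_ring
    rw [this, h1, hc]; abel
  have l : (m + K + W) * (m - K) = m * m := by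
    have : (m + K + W) * (m - K) = m * m - (m * K - K * m) + (W * m - W * K) - K * K := by
      noncomm_ring
    rw [this, ← hcw, h2, hc]; abel
  have hcomm : Commute (m - K) (m + K + W) := r.trans l.symm
  exact (hcomm.isUnit_mul_iff.mp (r ▸ hu)).1

/-- Triple homomorphisms between C*-algebras are contractive. If `‖a‖ < ‖S a‖ = ‖y‖`, then
`μ = ‖y‖²` lies outside the spectrum of `a* a`. The triple products of `a` and
`a * (a* a) (μ - a* a)⁻¹` are then linear combinations of these elements, and the resulting
identities in `B` produce a resolvent of `y* y` at `μ = ‖y* y‖`. -/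
theorem IsTripleHom.norm_map_le {A B : Type*} [NonUnitalCStarAlgebra A]
    [NonUnitalCStarAlgebra B] {S : A →ₗ[ℂ] B} (hS : IsTripleHom S) (a : A) :
    ‖S a‖ ≤ ‖a‖ := by
  by_contra! hlt
  set y := S a with hy
  set k := star y * y with hk
  set h := star a * a with hh
  set μ : ℝ := ‖k‖ with hμ
  have hhsa : IsSelfAdjoint h := IsSelfAdjoint.star_mul_self a
  have hks : star k = k := by simp [hk]
  have hμlt : ‖h‖ < μ := by
    rw [hμ, hk, hh, CStarRing.norm_star_mul_self, CStarRing.norm_star_mul_self]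
    exact mul_self_lt_mul_self (norm_nonneg _) hlt
  have hμ0 : 0 < μ := (norm_nonneg _).trans_lt hμlt
  have hne : ∀ x ∈ quasispectrum ℝ h, μ - x ≠ 0 := fun x hx ↦ by
    have := NonUnitalIsometricContinuousFunctionalCalculus.norm_quasispectrum_le h hx
    rw [Real.norm_eq_abs] at this
    linarith [le_abs_self x]
  have hcont : ContinuousOn (fun x : ℝ ↦ x / (μ - x)) (quasispectrum ℝ h) :=
    continuousOn_id.div (by fun_prop) hne
  set c := cfcₙ (fun x : ℝ ↦ x / (μ - x)) h with hc
  have hcs : star c = c := (cfcₙ_predicate (R := ℝ) (fun x : ℝ ↦ x / (μ - x)) h).star_eq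
  have hch : c * h = μ • c - h := by
    have h1 : c * h = cfcₙ (fun x : ℝ ↦ x / (μ - x) * x) h := by
      rw [cfcₙ_mul _ _ h hcont (by simp) (by fun_prop) rfl, cfcₙ_id' ℝ h]
    have h2 : μ • c - h = cfcₙ (fun x : ℝ ↦ μ * (x / (μ - x)) - x) h := by
      rw [cfcₙ_sub _ _ h (by fun_prop) (by simp) (by fun_prop) rfl, cfcₙ_id' ℝ h,
        cfcₙ_const_mul _ _ h hcont (by simp)]
    rw [h1, h2]
    refine cfcₙ_congr fun x hx ↦ ?_
    have := hne x hx
    field_simp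
    ring
  have hhc : h * c = μ • c - h := by
    have := congrArg star hch
    simpa [hcs, hhsa.star_eq] using this
  set w := star y * S (a * c) with hw
  have hSh : S (a * h) = y * k := by
    have := hS.map_mul_star_mul_self a a
    simpa [mul_assoc] using this
  have hach : S (a * (μ • c - h)) = μ • S (a * c) - y * k := by
    rw [mul_sub, mul_smul_comm, map_sub, LinearMap.map_smul_of_tower, hSh]
  have e1 : k * star w = μ • w - k * k := by
    have := hS.map_mul_star_mul_self a (a * c)
    rw [star_mul, hcs, show a * (c * star a) * a = a * (c * h) by simp only [hh, mul_assoc], hch,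
      hach] at this
    have := congrArg (star y * ·) this
    simp only [mul_sub, mul_smul_comm] at this
    simp only [hw, star_mul, star_star]
    simp only [hk, mul_assoc] at this ⊢
    exact this.symm
  have e2 : w * k + k * w = (μ • w - k * k) + (μ • w - k * k) := by
    have := hS.map_mul_star_mul_add (a * c) a a
    rw [show a * c * star a * a = a * (c * h) by simp only [hh, mul_assoc],
      show a * star a * (a * c) = a * (h * c) by simp only [hh, mul_assoc], hch, hhc, hach] at this
    have := congrArg (star y * ·) this
    simp only [mul_sub, mul_add, mul_smul_comm] at this
    simp only [hw]
    simp only [hk, mul_assoc] at this ⊢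
    exact this.symm
  have e1' : w * k = μ • star w - k * k := by
    have := congrArg star e1
    simpa [hks] using this
  -- `d = w - w*` is skew-adjoint with `k d = μ d` and `μ d² = μ² d`, which forces `d = 0`.
  have hkd : k * (w - star w) = μ • (w - star w) := by
    rw [mul_sub, smul_sub, e1, eq_sub_of_add_eq' e2, e1']
    abel
  have hdk : (w - star w) * k = μ • (w - star w) := by
    have := congrArg star hkd
    simp only [star_mul, star_sub, star_star, hks, star_smul, star_trivial] at this
    rw [← neg_sub (star w) w, neg_mul, this, smul_neg]
  have hdd : (w - star w) * (w - star w) = μ • (w - star w) := by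
    have h1 : (w - star w) * k * star w = (w - star w) * (μ • w - k * k) := by
      rw [mul_assoc, e1]
    rw [mul_sub, ← mul_assoc (w - star w) k k, hdk, smul_mul_assoc, smul_mul_assoc, hdk,
      mul_smul_comm, ← smul_sub] at h1
    have := smul_right_injective B hμ0.ne' h1
    rw [mul_sub, this]
    abel
  have hd : w - star w = 0 := by
    have := congrArg star hdd
    simp only [star_mul, star_smul, star_trivial] at this
    rw [show star (w - star w) = -(w - star w) by simp, neg_mul_neg, hdd, smul_neg] at this
    have h2 : (2 * μ) • (w - star w) = 0 := by
      rw [two_mul, add_smul]; nth_rewrite 1 [this]; abel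
    exact (smul_eq_zero.mp h2).resolve_left (by positivity)
  have hws : star w = w := (sub_eq_zero.mp hd).symm
  have : y = 0 := eq_zero_of_norm_smul_sub_mul_eq hws (by
    rw [hws] at e1; rw [← hk, ← hμ, e1]; abel)
  rw [this, norm_zero] at hlt
  exact (norm_nonneg a).not_gt hlt

/-! ### Tent functions -/

/-- The piecewise linear function supported on `[i - 1, i + 1]` with value `1` at the node `i`. -/
def tent (i : ℤ) (t : ℝ) : ℝ := max 0 (1 - |t - i|)

lemma continuous_tent (i : ℤ) : Continuous (tent i) := by
  unfold tent
  fun_prop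

lemma tent_nonneg (i : ℤ) (t : ℝ) : 0 ≤ tent i t := le_max_left _ _

lemma tent_eq_zero {i : ℤ} {t : ℝ} (h : 1 ≤ |t - i|) : tent i t = 0 :=
  max_eq_left (by linarith)

lemma tent_mul_tent {i j : ℤ} (h : 2 ≤ |i - j|) (t : ℝ) : tent i t * tent j t = 0 := by
  by_contra hne
  have hi : |t - i| < 1 := by
    by_contra! h'
    exact hne (by rw [tent_eq_zero h', zero_mul])
  have hj : |t - j| < 1 := by
    by_contra! h'
    exact hne (by rw [tent_eq_zero h', mul_zero])
  have h2 : (2 : ℝ) ≤ |(i : ℝ) - j| := by exact_mod_cast h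
  have := abs_sub_le (i : ℝ) t j
  rw [abs_sub_comm (i : ℝ) t] at this
  linarith

/-- Tent functions interpolate linearly between consecutive integers. -/
lemma sum_mul_tent {N : ℤ} {t : ℝ} (ht : |t| ≤ N) (c : ℤ → ℝ) :
    ∑ i ∈ Finset.Icc (-N) N, c i * tent i t =
      c ⌊t⌋ * (1 - Int.fract t) + c (⌊t⌋ + 1) * Int.fract t := by
  have h0 := Int.fract_nonneg t
  have h1 := Int.fract_lt_one t
  have hfr : t - ⌊t⌋ = Int.fract t := rfl
  have e1 : tent ⌊t⌋ t = 1 - Int.fract t := by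
    rw [tent, hfr, abs_of_nonneg h0, max_eq_right (by linarith)]
  have e2 : tent (⌊t⌋ + 1) t = Int.fract t := by
    rw [tent, Int.cast_add, Int.cast_one, ← sub_sub, hfr, abs_of_nonpos (by linarith),
      max_eq_right (by linarith)]
    ring
  have hs : ∑ i ∈ ({⌊t⌋, ⌊t⌋ + 1} : Finset ℤ), c i * tent i t =
      c ⌊t⌋ * (1 - Int.fract t) + c (⌊t⌋ + 1) * Int.fract t := by
    rw [Finset.sum_pair (by simp), e1, e2]
  rw [← hs]
  refine (Finset.sum_subset (Finset.subset_union_left (s₂ := {⌊t⌋, ⌊t⌋ + 1})) ?_).trans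
    (Finset.sum_subset (Finset.subset_union_right (s₁ := Finset.Icc (-N) N)) ?_).symm
  rotate_left
  · intro i _ hi
    simp only [Finset.mem_insert, Finset.mem_singleton, not_or] at hi
    rw [tent_eq_zero, mul_zero]
    rcases lt_or_gt_of_ne hi.1 with h | h
    · have : (i : ℝ) + 1 ≤ ⌊t⌋ := by exact_mod_cast h
      exact le_trans (by linarith) (le_abs_self _)
    · have : ⌊t⌋ + 2 ≤ i := by have := hi.2; omega
      have : (⌊t⌋ : ℝ) + 2 ≤ i := by exact_mod_cast this
      exact le_trans (by linarith) (neg_le_abs _)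
  · intro i _ hi
    rw [tent_eq_zero, mul_zero]
    rw [abs_le] at ht
    rw [Finset.mem_Icc, not_and_or, not_le, not_le] at hi
    rcases hi with h | h
    · have : (i : ℝ) + 1 ≤ -N := by exact_mod_cast h
      exact le_trans (by linarith) (le_abs_self _)
    · have : (N : ℝ) + 1 ≤ i := by exact_mod_cast h
      exact le_trans (by linarith) (neg_le_abs _)

lemma sum_tent {N : ℤ} {t : ℝ} (ht : |t| ≤ N) : ∑ i ∈ Finset.Icc (-N) N, tent i t = 1 := by
  simpa using sum_mul_tent ht fun _ ↦ 1

lemma sum_id_mul_tent {N : ℤ} {t : ℝ} (ht : |t| ≤ N) :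
    ∑ i ∈ Finset.Icc (-N) N, (i : ℝ) * tent i t = t := by
  rw [sum_mul_tent ht fun i ↦ (i : ℝ)]
  push_cast
  linear_combination Int.floor_add_fract t

/-! ### Bilinear sums concentrated near the diagonal -/

/-- Grouping the indices by their residues modulo `3` turns the nonzero terms of
`∑ i, j, (i - j) u i v j`, which have `i - j = ± 1`, into six products of partial sums. This is
why the bound does not grow with the number of terms. -/
lemma norm_sum_smul_mul_sum_sub_le {B : Type*} [NonUnitalNormedRing B] [NormedSpace ℝ B]
    [IsScalarTower ℝ B B] [SMulCommClass ℝ B B] {u v : ℤ → B} {K : Finset ℤ} {C D : ℝ}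
    (huv : ∀ i j, 2 ≤ |i - j| → u i * v j = 0)
    (hu : ∀ I ⊆ K, ‖∑ i ∈ I, u i‖ ≤ C) (hv : ∀ I ⊆ K, ‖∑ i ∈ I, v i‖ ≤ D) :
    ‖(∑ i ∈ K, (i : ℝ) • u i) * (∑ j ∈ K, v j) - (∑ i ∈ K, u i) * (∑ j ∈ K, (j : ℝ) • v j)‖
      ≤ 6 * (C * D) := by
  let U (r : ZMod 3) : B := ∑ i ∈ K with ((i : ℤ) : ZMod 3) = r, u i
  let V (r : ZMod 3) : B := ∑ i ∈ K with ((i : ℤ) : ZMod 3) = r, v i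
  have hU r : ‖U r‖ ≤ C := hu _ (Finset.filter_subset _ _)
  have hV r : ‖V r‖ ≤ D := hv _ (Finset.filter_subset _ _)
  have hUV r s : ‖U r * V s‖ ≤ C * D :=
    (norm_mul_le _ _).trans
      (mul_le_mul (hU r) (hV s) (norm_nonneg _) ((norm_nonneg _).trans (hU r)))
  have e1 : ∑ r, U (r + 1) * V r =
      ∑ i ∈ K, ∑ j ∈ K, if (i : ZMod 3) = j + 1 then u i * v j else 0 := by
    simp only [U, V, Finset.sum_filter, Finset.sum_mul_sum]
    rw [Finset.sum_comm]
    refine Finset.sum_congr rfl fun i _ ↦ ?_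
    rw [Finset.sum_comm]
    refine Finset.sum_congr rfl fun j _ ↦ ?_
    simp
  have e2 : ∑ r, U r * V (r + 1) =
      ∑ i ∈ K, ∑ j ∈ K, if (j : ZMod 3) = i + 1 then u i * v j else 0 := by
    simp only [U, V, Finset.sum_filter, Finset.sum_mul_sum]
    rw [Finset.sum_comm]
    refine Finset.sum_congr rfl fun i _ ↦ ?_
    rw [Finset.sum_comm]
    refine Finset.sum_congr rfl fun j _ ↦ ?_
    simp only [ite_mul, zero_mul, mul_ite, mul_zero]
    rw [Finset.sum_eq_single (i : ZMod 3) (fun r _ hr ↦ by simp [hr.symm]) (by simp)]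
    simp
  have key : (∑ i ∈ K, (i : ℝ) • u i) * (∑ j ∈ K, v j) -
      (∑ i ∈ K, u i) * (∑ j ∈ K, (j : ℝ) • v j) =
      ∑ r : ZMod 3, (U (r + 1) * V r - U r * V (r + 1)) := by
    rw [Finset.sum_sub_distrib, e1, e2, Finset.sum_mul_sum, Finset.sum_mul_sum,
      ← Finset.sum_sub_distrib, ← Finset.sum_sub_distrib]
    refine Finset.sum_congr rfl fun i _ ↦ ?_
    rw [← Finset.sum_sub_distrib, ← Finset.sum_sub_distrib]
    refine Finset.sum_congr rfl fun j _ ↦ ?_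
    rw [smul_mul_assoc, mul_smul_comm, ← sub_smul]
    by_cases hij : 2 ≤ |i - j|
    · simp [huv i j hij]
    · have h1 : (1 : ZMod 3) ≠ 0 := by decide
      have h2 : (1 + 1 : ZMod 3) ≠ 0 := by decide
      obtain rfl | rfl | rfl : i = j ∨ i = j + 1 ∨ j = i + 1 := by
        rw [not_le, abs_lt] at hij; omega
      · simp
      · simp [add_assoc, h2]
      · simp [add_assoc, h2]
  rw [key]
  refine (norm_sum_le _ _).trans ?_
  refine (Finset.sum_le_sum (g := fun _ ↦ C * D + C * D) fun r _ ↦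
    (norm_sub_le _ _).trans (add_le_add (hUV _ _) (hUV _ _))).trans_eq ?_
  rw [Finset.sum_const, Finset.card_univ, ZMod.card, nsmul_eq_mul]
  push_cast
  ring

/-! ### Right multiplication by continuous functions of a self-adjoint element -/

section RightMul

variable {A : Type*} [NonUnitalCStarAlgebra A]

/-- The element `a f(h)` of `A`. Since `f(h)` lies in the unitization of `A` if `f 0 ≠ 0`, the
constant part of `f` is split off. -/
noncomputable def mulCfc (a h : A) (f : ℝ → ℝ) : A :=
  f 0 • a + a * cfcₙ (fun t ↦ f t - f 0) h

lemma mulCfc_congr (a : A) {h : A} {f g : ℝ → ℝ} (hfg : (quasispectrum ℝ h).EqOn f g) :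
    mulCfc a h f = mulCfc a h g := by
  have h0 := hfg (quasispectrum.zero_mem ℝ h)
  unfold mulCfc
  rw [cfcₙ_congr (f := fun t ↦ f t - f 0) (g := fun t ↦ g t - g 0), h0]
  intro t ht
  simp only [hfg ht, h0]

lemma mulCfc_one (a h : A) : mulCfc a h (fun _ ↦ 1) = a := by
  simp [mulCfc]

lemma mulCfc_id (a : A) {h : A} (hh : IsSelfAdjoint h) : mulCfc a h (fun t ↦ t) = a * h := by
  simp [mulCfc, cfcₙ_id' ℝ h]

lemma mulCfc_sum (a : A) {h : A} {ι : Type*} (I : Finset ι) (w : ι → ℝ)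
    {f : ι → ℝ → ℝ} (hf : ∀ i, Continuous (f i)) :
    ∑ i ∈ I, w i • mulCfc a h (f i) = mulCfc a h (fun t ↦ ∑ i ∈ I, w i * f i t) := by
  have e (i) : w i • cfcₙ (fun t ↦ f i t - f i 0) h =
      cfcₙ (fun t ↦ w i * (f i t - f i 0)) h := by
    have := hf i
    rw [cfcₙ_const_mul _ _ h (by fun_prop) (by simp)]
  simp only [mulCfc, smul_add, Finset.sum_add_distrib, ← mul_smul_comm, e, ← Finset.mul_sum,
    smul_smul, ← Finset.sum_smul]
  rw [← cfcₙ_sum _ h I (fun i _ ↦ by have := hf i; fun_prop) (by simp)]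
  simp only [mul_sub]
  congr! 3
  ext t
  simp

lemma mulCfc_mul_star_mulCfc (a b : A) {h : A} {f g : ℝ → ℝ} (hf : Continuous f)
    (hg : Continuous g) (hfg : ∀ t, f t * g t = 0) :
    mulCfc a h f * star (mulCfc b h g) = 0 := by
  have hs : star (cfcₙ (fun t ↦ g t - g 0) h) = cfcₙ (fun t ↦ g t - g 0) h :=
    (cfcₙ_predicate (R := ℝ) (fun t ↦ g t - g 0) h).star_eq
  have e : f 0 • cfcₙ (fun t ↦ g t - g 0) h + g 0 • cfcₙ (fun t ↦ f t - f 0) h +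
      cfcₙ (fun t ↦ f t - f 0) h * cfcₙ (fun t ↦ g t - g 0) h = 0 := by
    rw [← cfcₙ_mul _ _ h (by fun_prop) (by simp) (by fun_prop) (by simp),
      ← cfcₙ_const_mul _ _ h (by fun_prop) (by simp),
      ← cfcₙ_const_mul _ _ h (by fun_prop) (by simp),
      ← cfcₙ_add _ _ h (by fun_prop) (by simp) (by fun_prop) (by simp),
      ← cfcₙ_add _ _ h (by fun_prop) (by simp) (by fun_prop) (by simp),
      ← cfcₙ_const_zero ℝ h]
    refine cfcₙ_congr fun t _ ↦ ?_
    linear_combination hfg t - hfg 0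
  have : mulCfc a h f * star (mulCfc b h g) = (f 0 * g 0) • (a * star b) +
      a * (f 0 • cfcₙ (fun t ↦ g t - g 0) h + g 0 • cfcₙ (fun t ↦ f t - f 0) h +
      cfcₙ (fun t ↦ f t - f 0) h * cfcₙ (fun t ↦ g t - g 0) h) * star b := by
    simp only [mulCfc, star_add, star_smul, star_mul, star_trivial, hs, add_mul, mul_add,
      smul_mul_assoc, mul_smul_comm, smul_smul, mul_assoc, smul_add, mul_comm (g 0)]
    abel
  rw [this, e, hfg]
  simp

lemma norm_mulCfc_le (a : A) {h : A} {f : ℝ → ℝ} (hf : ∀ t ∈ quasispectrum ℝ h, |f t| ≤ 1) :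
    ‖mulCfc a h f‖ ≤ 3 * ‖a‖ := by
  have h0 := hf 0 (quasispectrum.zero_mem ℝ h)
  have h1 : ‖cfcₙ (fun t ↦ f t - f 0) h‖ ≤ 2 := norm_cfcₙ_le fun t ht ↦ by
    have := hf t ht
    rw [Real.norm_eq_abs]
    linarith [abs_sub (f t) (f 0)]
  calc ‖mulCfc a h f‖ ≤ ‖f 0 • a‖ + ‖a * cfcₙ (fun t ↦ f t - f 0) h‖ := norm_add_le _ _
    _ ≤ 1 * ‖a‖ + ‖a‖ * 2 := by
      gcongr
      · rw [norm_smul]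
        exact mul_le_mul_of_nonneg_right h0 (norm_nonneg _)
      · exact (norm_mul_le _ _).trans (by gcongr)
    _ = 3 * ‖a‖ := by ring

end RightMul

/-! ### Maps preserving the orthogonality `a b* = 0` -/

section ZeroProducts

variable {A B : Type*} [NonUnitalCStarAlgebra A] [NonUnitalCStarAlgebra B]

/-- The right-hand side does not depend on `h`, so replacing `h` by its multiples shows that the
left-hand side vanishes. -/
lemma norm_map_mul_mul_star_sub_le (S : A →L[ℂ] B)
    (hS : ∀ a b : A, a * star b = 0 → S a * star (S b) = 0) (a b : A) {h : A}
    (hh : IsSelfAdjoint h) :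
    ‖S (a * h) * star (S b) - S a * star (S (b * h))‖ ≤
      6 * ((‖S‖ * (3 * ‖a‖)) * (‖S‖ * (3 * ‖b‖))) := by
  obtain ⟨N, hN⟩ := exists_nat_ge ‖h‖
  have hsp : ∀ t ∈ quasispectrum ℝ h, |t| ≤ (N : ℤ) := fun t ht ↦
    (NonUnitalIsometricContinuousFunctionalCalculus.norm_quasispectrum_le h ht).trans
      (by exact_mod_cast hN)
  set K : Finset ℤ := Finset.Icc (-(N : ℤ)) N
  have hone (x : A) : ∑ i ∈ K, mulCfc x h (tent i) = x := by
    have := mulCfc_sum x (h := h) K (fun _ ↦ 1) continuous_tent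
    simp only [one_smul, one_mul] at this
    rw [this, mulCfc_congr x (g := fun _ ↦ 1) fun t ht ↦ sum_tent (hsp t ht), mulCfc_one]
  have hid (x : A) : ∑ i ∈ K, (i : ℝ) • mulCfc x h (tent i) = x * h := by
    rw [mulCfc_sum x (h := h) K (fun i ↦ (i : ℝ)) continuous_tent,
      mulCfc_congr x (g := fun t ↦ t) fun t ht ↦ sum_id_mul_tent (hsp t ht), mulCfc_id x hh]
  have hbd (x : A) (I : Finset ℤ) (hI : I ⊆ K) :
      ‖∑ i ∈ I, S (mulCfc x h (tent i))‖ ≤ ‖S‖ * (3 * ‖x‖) := by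
    rw [← map_sum]
    refine (S.le_opNorm _).trans (mul_le_mul_of_nonneg_left ?_ (norm_nonneg _))
    have := mulCfc_sum x (h := h) I (fun _ ↦ 1) continuous_tent
    simp only [one_smul, one_mul] at this
    rw [this]
    refine norm_mulCfc_le x fun t ht ↦ ?_
    rw [abs_of_nonneg (Finset.sum_nonneg fun i _ ↦ tent_nonneg i t), ← sum_tent (hsp t ht)]
    exact Finset.sum_le_sum_of_subset_of_nonneg hI fun i _ _ ↦ tent_nonneg i t
  have key := norm_sum_smul_mul_sum_sub_le (K := K)
    (u := fun i ↦ S (mulCfc a h (tent i))) (v := fun j ↦ star (S (mulCfc b h (tent j))))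
    (fun i j hij ↦ hS _ _ (mulCfc_mul_star_mulCfc a b (continuous_tent i) (continuous_tent j)
      (tent_mul_tent hij))) (hbd a)
    (fun I hI ↦ by rw [← star_sum, norm_star]; exact hbd b I hI)
  have hstar (i : ℤ) : (i : ℝ) • star (S (mulCfc b h (tent i))) =
      star ((i : ℝ) • S (mulCfc b h (tent i))) := by rw [star_smul, star_trivial (i : ℝ)]
  have hsm (x : A) (i : ℤ) : (i : ℝ) • S (mulCfc x h (tent i)) =
      S ((i : ℝ) • mulCfc x h (tent i)) := (S.map_smul_of_tower _ _).symm
  simp only [hstar, hsm, ← star_sum, ← map_sum, hone, hid] at key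
  exact key

lemma map_mul_mul_star_of_isSelfAdjoint (S : A →L[ℂ] B)
    (hS : ∀ a b : A, a * star b = 0 → S a * star (S b) = 0) (a b : A) {h : A}
    (hh : IsSelfAdjoint h) :
    S (a * h) * star (S b) = S a * star (S (b * h)) := by
  rw [← sub_eq_zero, ← norm_le_zero_iff]
  by_contra! hpos
  obtain ⟨n, hn⟩ := exists_nat_gt (6 * ((‖S‖ * (3 * ‖a‖)) * (‖S‖ * (3 * ‖b‖))) /
    ‖S (a * h) * star (S b) - S a * star (S (b * h))‖)
  rw [div_lt_iff₀ hpos] at hn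
  have := norm_map_mul_mul_star_sub_le S hS a b (h := n • h) (.smul (.all n) hh)
  rw [mul_smul_comm, mul_smul_comm, map_nsmul, map_nsmul, star_nsmul, smul_mul_assoc,
    mul_smul_comm, ← smul_sub, ← Nat.cast_smul_eq_nsmul ℝ, norm_smul, RCLike.norm_natCast] at this
  linarith

/-- The sesquilinear form `S a (S b)*` of an orthogonality preserving map is balanced. -/
theorem map_mul_mul_star (S : A →L[ℂ] B)
    (hS : ∀ a b : A, a * star b = 0 → S a * star (S b) = 0) (a b x : A) :
    S (a * x) * star (S b) = S a * star (S (b * star x)) := by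
  have h1 := map_mul_mul_star_of_isSelfAdjoint S hS a b (realPart x).2
  have h2 := map_mul_mul_star_of_isSelfAdjoint S hS a b (imaginaryPart x).2
  have hx := realPart_add_I_smul_imaginaryPart x
  have hsx : star x = (realPart x : A) - Complex.I • (imaginaryPart x : A) := by
    conv_lhs => rw [← hx]
    rw [star_add, star_smul, (realPart x).2.star_eq, (imaginaryPart x).2.star_eq]
    simp [sub_eq_add_neg]
  rw [hsx]
  conv_lhs => rw [← hx]
  rw [mul_add, map_add, add_mul, mul_sub, map_sub, star_sub, mul_sub, h1, mul_smul_comm,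
    mul_smul_comm, map_smul, map_smul, smul_mul_assoc, h2, star_smul, mul_smul_comm]
  simp [sub_eq_add_neg]

end ZeroProducts

/-! ### Triple homomorphisms preserving orthogonality -/

/-- Moving factors through the middle variable gives `E (a y) b c = E a b (c y)`, so that
`E (x v) b (x w) = E x b (x w v)`. For `z = w v`, moving `z` from right to left and antisymmetry
give `E x b (x z) = E (x z) b x = -E x b (x z)`. -/
lemma eq_zero_of_antisymm_of_balanced {A B : Type*} [NonUnitalCStarAlgebra A]
    [NonUnitalCStarAlgebra B] {E : A → A → A → B}
    (hanti : ∀ a b c, E a b c = -E c b a)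
    (hbal : ∀ a b c x, E (a * x) b c = E a (b * star x) c) (b x v w : A) :
    E (x * v) b (x * w) = 0 := by
  have hmove (a b c y : A) : E (a * y) b c = E a b (c * y) := by
    rw [hbal, hanti a, ← hbal, ← hanti]
  have h (z : A) : E x b (x * z) = 0 := by
    have h1 := hmove x b x z
    rw [hanti (x * z)] at h1
    have h2 : (2 : ℂ) • E x b (x * z) = 0 := by
      rw [two_smul]; nth_rewrite 1 [← h1]; abel
    exact (smul_eq_zero.mp h2).resolve_left two_ne_zero
  rw [hmove, mul_assoc, h]

/-- A triple homomorphism preserving the relation `a b* = 0` preserves the ternary product. -/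
theorem IsTripleHom.isTROHom {A B : Type*} [NonUnitalCStarAlgebra A] [NonUnitalCStarAlgebra B]
    {S : A →ₗ[ℂ] B} (hS : IsTripleHom S)
    (h0 : ∀ a b : A, a * star b = 0 → S a * star (S b) = 0) : IsTROHom S := by
  let T : A →L[ℂ] B := S.mkContinuous 1 fun a ↦ by simpa using hS.norm_map_le a
  have hcont : Continuous S := T.continuous
  have hT (a b x : A) : S (a * x) * star (S b) = S a * star (S (b * star x)) :=
    map_mul_mul_star T h0 a b x
  let E (a b c : A) : B := S a * star (S b) * S c - S (a * star b * c)
  have hE (b x v w : A) : E (x * v) b (x * w) = 0 := by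
    refine eq_zero_of_antisymm_of_balanced (fun a b c ↦ ?_) (fun a b c x ↦ ?_) b x v w
    · have := hS.map_mul_star_mul_add a b c
      simp only [E]
      rw [eq_neg_iff_add_eq_zero, sub_add_sub_comm, this, sub_self]
    · simp only [E]
      rw [hT, star_mul, star_star, mul_assoc a x (star b)]
  intro a b c
  -- `E (e a) b (e c) = 0` passes to the limit along an approximate unit `e`.
  let _ := CStarAlgebra.spectralOrder A
  have := CStarAlgebra.spectralOrderedRing A
  have hl := (CStarAlgebra.increasingApproximateUnit A).toIsApproximateUnit
  have := hl.neBot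
  have hEc : Continuous fun p : A × A ↦ E p.1 b p.2 := by
    simp only [E]
    fun_prop
  have hlim := (hEc.tendsto (a, c)).comp
    ((hl.tendsto_mul_right a).prodMk_nhds (hl.tendsto_mul_right c))
  have hzero : E a b c = 0 := tendsto_nhds_unique hlim
    (by simp only [Function.comp_def, hE]; exact tendsto_const_nhds)
  exact (sub_eq_zero.mp hzero).symm

theorem proposition2p4 {A B : Type*} [NonUnitalCStarAlgebra A] [NonUnitalCStarAlgebra B]
    (S : A →ₗ[ℂ] B) (hS : IsTripleHom S) :
    List.TFAE [
      IsTROHom S,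
      PreservesZeroTROProducts S,
      ∀ a b : A, a * star b = 0 → S a * star (S b) = 0] := by
  tfae_have 1 → 2 := fun h a b c habc ↦ by rw [← h, habc, map_zero]
  tfae_have 2 → 3 := fun h a b hab ↦ by
    -- If `z = S a (S b)*`, then `[S a, S b, S b] = 0` gives `z z* = 0`.
    have h1 : S a * star (S b) * S b = 0 := h a b b (by rw [troProduct, hab, zero_mul])
    rw [← CStarRing.mul_star_self_eq_zero_iff, star_mul, star_star, ← mul_assoc, h1, zero_mul]
  tfae_have 3 → 1 := hS.isTROHom
  tfae_finish
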